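/- Let $(X,\rho)$ be a complete separable metric space with its Borel $\sigma$-algebra. Write $B(x,r)$ for the open ball, $\mathcal M_1$ for the set of Borel probability measures on $X$, $B_b(X)$ for the bounded Borel functions and $C_b(X)$ for the bounded continuous functions $X\to\mathbb R$. Let $(P_t)_{t\ge0}$ be a Markovian semigroup on $B_b(X)$, that is, $P_t\psi(x)=\int_X\psi(y)\,P_t(x,dy)$ for transition probability kernels $P_t(x,dy)$ with $P_0=\mathrm{Id}$ and $P_{s+t}=P_sP_t$ for $s,t\ge0$. For $\mu\in\mathcal M_1$ and Borel $A\subset X$ put $P_t^*\mu(A)=\int_X P_t\mathbf 1_A\,d\mu$. Assume that $(P_t)_{t\ge0}$ is Feller ($P_t(C_b(X))\subset C_b(X)$ for all $t>0$) and stochastically continuous ($\lim_{t\to0^+}P_t\psi(x)=\psi(x)$ for all $\psi\in C_b(X)$ and $x\in X$). Suppose that there is a point $z\in X$ such that, for every $\varepsilon>0$, $$\limsup_{T\to\infty}\ \sup_{\mu\in\mathcal M_1}\ \frac1T\int_0^T P_s^*\mu(B(z,\varepsilon))\,ds>0,$$ and that $(P_t)_{t\ge0}$ has the e-property: for every bounded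 Lipschitz function $\psi:X\to\mathbb R$, every $x\in X$ and every $\varepsilon>0$ there is $\delta>0$ such that $|P_t\psi(x)-P_t\psi(y)|<\varepsilon$ for all $y\in B(x,\delta)$ and all $t\ge0$. Then $(P_t)_{t\ge0}$ admits an invariant measure: there is $\mu_*\in\mathcal M_1$ with $\int_X P_t\psi\,d\mu_*=\int_X\psi\,d\mu_*$ for every $\psi\in B_b(X)$ and every $t\ge0$. -/

import Mathlib

open MeasureTheory ProbabilityTheory Filter Topology
open scoped NNReal ENNReal BoundedContinuousFunction

/-- A Markovian semigroup on a measurable space `X`, given by its transition probabilities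
`P_t(x, dy)`, `t ≥ 0`: Markov kernels with `P_0(x, ·) = δ_x` that satisfy the
Chapman-Kolmogorov equations.  It acts on functions through `MarkovSemigroup.op` and on measures
through `MarkovSemigroup.dual`. -/
structure MarkovSemigroup (X : Type*) [MeasurableSpace X] where
  kernel : ℝ≥0 → Kernel X X
  isMarkovKernel : ∀ t, IsMarkovKernel (kernel t)
  kernel_zero : kernel 0 = Kernel.id
  kernel_add : ∀ s t, kernel (s + t) = kernel t ∘ₖ kernel s

namespace MarkovSemigroup

attribute [instance] MarkovSemigroup.isMarkovKernel

/-- The operator `P_t` on functions: `P_t ψ (x) = ∫ ψ(y) P_t(x, dy)`. It is used for bounded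
measurable `ψ`. -/
noncomputable def op {X : Type*} [MeasurableSpace X] (P : MarkovSemigroup X)
    (t : ℝ≥0) (ψ : X → ℝ) : X → ℝ :=
  fun x => ∫ y, ψ y ∂(P.kernel t x)

/-- The dual operator `P_t^*` on measures: `P_t^* μ (A) = ∫ P_t(x, A) μ(dx)`. -/
noncomputable def dual {X : Type*} [MeasurableSpace X] (P : MarkovSemigroup X)
    (t : ℝ≥0) (μ : Measure X) : Measure X :=
  μ.bind (P.kernel t)

/-- The Feller property: `P_t` maps bounded continuous functions to continuous functions
(boundedness of `P_t ψ` is automatic, see `abs_op_le`). -/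
def IsFeller {X : Type*} [MeasurableSpace X] [TopologicalSpace X]
    (P : MarkovSemigroup X) : Prop :=
  ∀ t : ℝ≥0, 0 < t → ∀ ψ : X →ᵇ ℝ, Continuous (P.op t ψ)

/-- Stochastic continuity: `P_t ψ (x) → ψ(x)` as `t → 0+` for bounded continuous `ψ`. -/
def IsStochasticallyContinuous {X : Type*} [MeasurableSpace X] [TopologicalSpace X]
    (P : MarkovSemigroup X) : Prop :=
  ∀ (ψ : X →ᵇ ℝ) (x : X), Tendsto (fun t : ℝ≥0 => P.op t ψ x) (𝓝[>] 0) (𝓝 (ψ x))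

/-- The e-property: for every bounded Lipschitz `ψ` the family `(P_t ψ)_{t ≥ 0}` is equicontinuous
at every point. -/
def HasEProperty {X : Type*} [MeasurableSpace X] [PseudoMetricSpace X]
    (P : MarkovSemigroup X) : Prop :=
  ∀ ψ : X → ℝ, (∃ C : ℝ, ∀ x, |ψ x| ≤ C) → (∃ L : ℝ≥0, LipschitzWith L ψ) →
    ∀ (x : X) (ε : ℝ), 0 < ε → ∃ δ : ℝ, 0 < δ ∧
      ∀ z ∈ Metric.ball x δ, ∀ t : ℝ≥0, |P.op t ψ x - P.op t ψ z| < ε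

/-- `μ` is invariant: `⟨P_t ψ, μ⟩ = ⟨ψ, μ⟩` for all bounded measurable `ψ` and all `t ≥ 0`. -/
def IsInvariant {X : Type*} [MeasurableSpace X] (P : MarkovSemigroup X)
    (μ : Measure X) : Prop :=
  ∀ ψ : X → ℝ, Measurable ψ → (∃ C : ℝ, ∀ x, |ψ x| ≤ C) →
    ∀ t : ℝ≥0, ∫ x, P.op t ψ x ∂μ = ∫ x, ψ x ∂μ

/-- The time average `(1/T) ∫_0^T P_s^* μ (A) ds`, for `T > 0`. -/
noncomputable def timeAverage {X : Type*} [MeasurableSpace X] (P : MarkovSemigroup X)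
    (T : ℝ) (μ : Measure X) (A : Set X) : ℝ≥0∞ :=
  (ENNReal.ofReal T)⁻¹ * ∫⁻ s in Set.Ioc (0 : ℝ) T, P.dual s.toNNReal μ A

theorem abs_op_le {X : Type*} [MeasurableSpace X] (P : MarkovSemigroup X) (t : ℝ≥0)
    {ψ : X → ℝ} {C : ℝ} (h : ∀ x, |ψ x| ≤ C) (x : X) : |P.op t ψ x| ≤ C := by
  have := norm_integral_le_of_norm_le_const (μ := P.kernel t x) (f := ψ) (C := C)
    (Eventually.of_forall h)
  simpa [op] using this

/-- `P_t` maps measurable functions to measurable functions. -/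
theorem measurable_op {X : Type*} [MeasurableSpace X] (P : MarkovSemigroup X) (t : ℝ≥0)
    {ψ : X → ℝ} (h : Measurable ψ) : Measurable (P.op t ψ) :=
  (h.stronglyMeasurable.integral_kernel (κ := P.kernel t)).measurable

instance dual_isProbabilityMeasure {X : Type*} [MeasurableSpace X] (P : MarkovSemigroup X)
    (t : ℝ≥0) (μ : Measure X) [IsProbabilityMeasure μ] : IsProbabilityMeasure (P.dual t μ) := by
  unfold dual
  infer_instance

/-- `P_t^* μ (A) = ⟨P_t 1_A, μ⟩`. -/
theorem dual_apply {X : Type*} [MeasurableSpace X] (P : MarkovSemigroup X) (t : ℝ≥0)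
    (μ : Measure X) [IsProbabilityMeasure μ] {A : Set X} (hA : MeasurableSet A) :
    (P.dual t μ).real A = ∫ x, P.op t (A.indicator 1) x ∂μ := by
  have h1 : ∀ x, P.op t (A.indicator 1) x = (P.kernel t x A).toReal := fun x => by
    simp [op, integral_indicator_one hA, Measure.real]
  simp only [h1]
  rw [integral_toReal (Kernel.measurable_coe _ hA).aemeasurable
    (Eventually.of_forall fun x => measure_lt_top _ _), Measure.real, dual,
    Measure.bind_apply hA (Kernel.measurable _).aemeasurable]

/-- The semigroup law `P_{s+t} = P_s P_t` on bounded measurable functions. -/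
theorem op_add {X : Type*} [MeasurableSpace X] (P : MarkovSemigroup X) (s t : ℝ≥0)
    {ψ : X → ℝ} (hψ : Measurable ψ) (hb : ∃ C : ℝ, ∀ x, |ψ x| ≤ C) :
    P.op (s + t) ψ = P.op s (P.op t ψ) := by
  obtain ⟨C, hC⟩ := hb
  funext x
  simp only [op, P.kernel_add]
  rw [Kernel.integral_comp]
  exact Integrable.of_bound hψ.aestronglyMeasurable C (Eventually.of_forall hC)

end MarkovSemigroup

/-! The orbit `P_t(z, ·)` is tight, and Krylov-Bogoliubov averaging of a tight orbit gives an
invariant measure. If tightness failed, there would be uniformly separated compact sets `K_i` and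
times `t_i` with `P_{t_i}(z, K_i) > ε` (`exists_separated_of_not_isTightMeasureSet`). Yet time
averages charge every ball around `z`, so the points of a ball cannot all send mass at least `η`
into each of infinitely many disjoint neighbourhoods `U_i`: the total mass would exceed one
(`exists_kernel_lt`). Hence arbitrarily close to `z` there are `x` with `P_{t_i}(x, U_i)` small. A
gliding hump (`exists_index_selection`) joins infinitely many `K_i` into one Lipschitz bump `F I`
such that `P_{t_i} (F I)` differs at `z` and at such `x` by more than `ε / 4`, against the
e-property (`not_separated_of_hasEProperty`). -/

theorem finsetSum_lintegral_le {α ι : Type*} [MeasurableSpace α] (μ : Measure α) (s : Finset ι)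
    (f : ι → α → ℝ≥0∞) : ∑ i ∈ s, ∫⁻ a, f i a ∂μ ≤ ∫⁻ a, ∑ i ∈ s, f i a ∂μ := by
  classical
  induction s using Finset.induction_on with
  | empty => simp
  | insert i s hi ih =>
    simp only [Finset.sum_insert hi]
    exact (add_le_add_right ih _).trans (le_lintegral_add _ _)

theorem setLIntegral_Ioc_comp_add (f : ℝ → ℝ≥0∞) (a b c : ℝ) :
    ∫⁻ s in Set.Ioc a b, f (s + c) = ∫⁻ s in Set.Ioc (a + c) (b + c), f s := by
  have h := (measurePreserving_add_right volume c).setLIntegral_comp_preimage_emb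
    (measurableEmbedding_addRight c) f (Set.Ioc (a + c) (b + c))
  rw [← h]
  simp

/-! ### Dual action and mass sent to disjoint sets. -/

namespace MarkovSemigroup

variable {X : Type*}

section Measurable

variable [MeasurableSpace X] (P : MarkovSemigroup X)

theorem dual_add (s t : ℝ≥0) (μ : Measure X) : P.dual (s + t) μ = P.dual t (P.dual s μ) := by
  simp only [dual, P.kernel_add]
  exact Measure.comp_assoc.symm

theorem dual_zero (μ : Measure X) : P.dual 0 μ = μ := by
  simp [dual, P.kernel_zero]

theorem integral_dual (t : ℝ≥0) (μ : Measure X) [IsProbabilityMeasure μ] {ψ : X → ℝ}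
    (hψ : Measurable ψ) (hb : ∃ C : ℝ, ∀ x, |ψ x| ≤ C) :
    ∫ x, ψ x ∂(P.dual t μ) = ∫ x, P.op t ψ x ∂μ := by
  obtain ⟨C, hC⟩ := hb
  have h : Integrable ψ ((P.kernel t ∘ₖ Kernel.const Unit μ) ()) :=
    Integrable.of_bound hψ.aestronglyMeasurable C (Eventually.of_forall hC)
  rw [dual, Measure.comp_eq_comp_const_apply, Kernel.integral_comp h]
  simp [op]

/-- Markov's inequality for `x ↦ P_t(x, U)` under `P_s^* μ`. -/
theorem mul_dual_le_dual_add (s t : ℝ≥0) (μ : Measure X) {B U : Set X}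
    (hU : MeasurableSet U) {η : ℝ≥0∞} (h : ∀ x ∈ B, η ≤ P.kernel t x U) :
    η * P.dual s μ B ≤ P.dual (s + t) μ U := by
  rw [dual_add, dual.eq_1 P t, Measure.bind_apply hU (Kernel.measurable _).aemeasurable]
  calc η * P.dual s μ B ≤ η * P.dual s μ {x | η ≤ P.kernel t x U} := by
        gcongr; exact h
    _ ≤ _ := mul_meas_ge_le_lintegral (Kernel.measurable_coe _ hU) η

/-- If all long time averages of some initial measures charge `B`, then disjoint sets cannot all be
reached from every point of `B` with probability at least `η`. -/
theorem exists_kernel_lt (B : Set X)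
    (hB : 0 < limsup (fun T : ℝ => ⨆ μ : ProbabilityMeasure X,
      P.timeAverage T (μ : Measure X) B) atTop)
    {U : ℕ → Set X} (hU : ∀ i, MeasurableSet (U i)) (hd : Pairwise (Function.onFun Disjoint U))
    (t : ℕ → ℝ≥0) {η : ℝ≥0∞} (hη : 0 < η) (m : ℕ) :
    ∃ i, m ≤ i ∧ ∃ x ∈ B, P.kernel (t i) x (U i) < η := by
  by_contra! hcon
  obtain ⟨c, hc0, hc⟩ := exists_between hB
  -- The bound 2 comes from the window: all shifted integrals lie in `(0, T + M]`, of length at most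
  -- `2T`.
  obtain ⟨N, hN⟩ := ENNReal.exists_nat_mul_gt (a := η * c) (b := 2)
    (mul_ne_zero hη.ne' hc0.ne') (by simp)
  set M : ℝ := ∑ i ∈ Finset.Ico m (m + N), (t i : ℝ)
  obtain ⟨T, hT, hTM⟩ := ((frequently_lt_of_lt_limsup (by isBoundedDefault) hc).and_eventually
    (eventually_ge_atTop (max 1 M))).exists
  have hT1 : 1 ≤ T := (le_max_left _ _).trans hTM
  have hTM' : M ≤ T := (le_max_right _ _).trans hTM
  have hT0 : ENNReal.ofReal T ≠ 0 := by simpa using by linarith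
  obtain ⟨μ, hμ⟩ := lt_iSup_iff.1 hT
  have h1 : c * ENNReal.ofReal T ≤
      ∫⁻ s in Set.Ioc (0 : ℝ) T, P.dual s.toNNReal (μ : Measure X) B := by
    rw [timeAverage, mul_comm, ← div_eq_mul_inv] at hμ
    exact (ENNReal.le_div_iff_mul_le (Or.inl hT0) (Or.inl ENNReal.ofReal_ne_top)).1 hμ.le
  have h2 : ∀ i ∈ Finset.Ico m (m + N), η * (c * ENNReal.ofReal T) ≤
      ∫⁻ s in Set.Ioc (0 : ℝ) (T + M), P.dual s.toNNReal (μ : Measure X) (U i) := by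
    intro i hi
    have htM : (t i : ℝ) ≤ M :=
      Finset.single_le_sum (f := fun i => (t i : ℝ)) (fun i _ => (t i).2) hi
    calc η * (c * ENNReal.ofReal T)
        ≤ η * ∫⁻ s in Set.Ioc (0 : ℝ) T, P.dual s.toNNReal (μ : Measure X) B := by gcongr
      _ ≤ ∫⁻ s in Set.Ioc (0 : ℝ) T, η * P.dual s.toNNReal (μ : Measure X) B :=
        lintegral_const_mul_le _ _
      _ ≤ ∫⁻ s in Set.Ioc (0 : ℝ) T, P.dual (s + t i).toNNReal (μ : Measure X) (U i) := by
        refine setLIntegral_mono' measurableSet_Ioc fun s hs => ?_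
        have hst : (s + t i).toNNReal = s.toNNReal + t i := by
          rw [Real.toNNReal_add hs.1.le (t i).coe_nonneg, Real.toNNReal_coe]
        rw [hst]
        exact P.mul_dual_le_dual_add _ _ _ (hU i) (hcon i (Finset.mem_Ico.1 hi).1)
      _ = ∫⁻ s in Set.Ioc (0 + t i : ℝ) (T + t i), P.dual s.toNNReal (μ : Measure X) (U i) :=
        setLIntegral_Ioc_comp_add (fun s => P.dual s.toNNReal (μ : Measure X) (U i)) 0 T (t i)
      _ ≤ _ := by
        refine lintegral_mono_set (Set.Ioc_subset_Ioc ?_ ?_)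
        · simp
        · linarith
  have h3 : N * (η * c) * ENNReal.ofReal T ≤ 2 * ENNReal.ofReal T := by
    calc N * (η * c) * ENNReal.ofReal T
        = ∑ i ∈ Finset.Ico m (m + N), η * (c * ENNReal.ofReal T) := by simp [mul_assoc]
      _ ≤ ∑ i ∈ Finset.Ico m (m + N),
          ∫⁻ s in Set.Ioc (0 : ℝ) (T + M), P.dual s.toNNReal (μ : Measure X) (U i) :=
        Finset.sum_le_sum h2
      -- Superadditivity of the lower integral suffices, so no measurability in `s` is needed.
      _ ≤ ∫⁻ s in Set.Ioc (0 : ℝ) (T + M), ∑ i ∈ Finset.Ico m (m + N),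
          P.dual s.toNNReal (μ : Measure X) (U i) := finsetSum_lintegral_le _ _ _
      _ ≤ ∫⁻ s in Set.Ioc (0 : ℝ) (T + M), 1 := by
        refine lintegral_mono fun s => ?_
        rw [← measure_biUnion_finset (fun i _ j _ hij => hd hij) (fun i _ => hU i)]
        exact prob_le_one
      _ = ENNReal.ofReal (T + M) := by simp
      _ ≤ ENNReal.ofReal (2 * T) := ENNReal.ofReal_le_ofReal (by linarith)
      _ = 2 * ENNReal.ofReal T := by rw [ENNReal.ofReal_mul (by norm_num)]; simp
  exact absurd h3 (not_le.2 ((ENNReal.mul_lt_mul_iff_left hT0 ENNReal.ofReal_ne_top).2 hN))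

end Measurable

end MarkovSemigroup

/-! ### Failure of tightness yields separated compact sets. -/

section Tight

open Metric

/-- An intersection of closed thickenings of compact sets with radii tending to zero is closed and
totally bounded, hence compact by completeness. The radii are also capped by a summable `δ n` to
control the lost mass. -/
theorem isTightMeasureSet_of_forall_thickening {X : Type*} [MetricSpace X] [CompleteSpace X]
    [MeasurableSpace X] [BorelSpace X] {S : Set (Measure X)}
    (h : ∀ ε : ℝ, 0 < ε → ∃ K : Set X, IsCompact K ∧
      ∀ μ ∈ S, μ (thickening ε K)ᶜ ≤ ENNReal.ofReal ε) : IsTightMeasureSet S := by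
  rw [isTightMeasureSet_iff_exists_isCompact_measure_compl_le]
  intro ε hε
  obtain ⟨δ, hδ0, hδ⟩ := ENNReal.exists_pos_sum_of_countable hε.ne' ℕ
  have hr : ∀ n : ℕ, 0 < min (δ n : ℝ) (1 / (n + 1 : ℝ)) := fun n =>
    lt_min (hδ0 n) (by positivity)
  choose K hK hKS using fun n => h _ (hr n)
  refine ⟨⋂ n, cthickening (min (δ n : ℝ) (1 / (n + 1 : ℝ))) (K n), ?_, fun μ hμ => ?_⟩
  · refine TotallyBounded.isCompact_of_isClosed ?_ (isClosed_iInter fun n => isClosed_cthickening)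
    rw [Metric.totallyBounded_iff]
    intro r hr0
    obtain ⟨n, hn⟩ := exists_nat_one_div_lt (half_pos hr0)
    obtain ⟨F, hF, hFK⟩ := Metric.totallyBounded_iff.1 (hK n).totallyBounded (r / 2) (half_pos hr0)
    refine ⟨F, hF, fun x hx => ?_⟩
    have hx' : x ∈ thickening (r / 2) (K n) :=
      cthickening_subset_thickening' (half_pos hr0) ((min_le_right _ _).trans_lt hn) _
        (Set.mem_iInter.1 hx n)
    obtain ⟨y, hy, hxy⟩ := mem_thickening_iff.1 hx'
    obtain ⟨w, hw, hyw⟩ := Set.mem_iUnion₂.1 (hFK hy)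
    refine Set.mem_iUnion₂.2 ⟨w, hw, ?_⟩
    rw [mem_ball] at hyw ⊢
    linarith [dist_triangle x y w]
  · rw [Set.compl_iInter]
    refine (measure_iUnion_le _).trans (le_trans (ENNReal.tsum_le_tsum fun n => ?_) hδ.le)
    refine (measure_mono (Set.compl_subset_compl.2 (thickening_subset_cthickening _ _))).trans
      ((hKS n μ hμ).trans ?_)
    rw [← ENNReal.ofReal_coe_nnreal]
    exact ENNReal.ofReal_le_ofReal (min_le_left _ _)

/-- Some measure gives mass above `ε` to the complement of the thickened union of the compacts
already chosen; inner regularity finds the next compact there. -/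
theorem exists_separated_of_not_isTightMeasureSet {X ι : Type*} [MetricSpace X] [CompleteSpace X]
    [TopologicalSpace.SeparableSpace X] [MeasurableSpace X] [BorelSpace X] {μ : ι → Measure X}
    [∀ i, IsFiniteMeasure (μ i)] (h : ¬ IsTightMeasureSet (Set.range μ)) :
    ∃ ε : ℝ, 0 < ε ∧ ∃ (K : ℕ → Set X) (t : ℕ → ι), (∀ n, IsCompact (K n)) ∧
      (∀ n, ENNReal.ofReal ε < μ (t n) (K n)) ∧
      ∀ m n, m < n → Disjoint (thickening ε (K m)) (K n) := by
  have : SecondCountableTopology X := UniformSpace.secondCountable_of_separable X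
  have h' := mt isTightMeasureSet_of_forall_thickening h
  push Not at h'
  obtain ⟨ε, hε, hK⟩ := h'
  obtain ⟨f, hf, hfd⟩ := exists_seq_of_forall_finset_exists
    (fun p : Set X × ι => IsCompact p.1 ∧ ENNReal.ofReal ε < μ p.2 p.1)
    (fun p q => Disjoint (thickening ε p.1) q.1) (by
      intro s hs
      obtain ⟨_, ⟨t, rfl⟩, ht⟩ := hK (⋃ p ∈ s, p.1) (s.isCompact_biUnion fun p hp => (hs p hp).1)
      obtain ⟨C, hCs, hC, hCt⟩ := isOpen_thickening.measurableSet.compl.exists_lt_isCompact ht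
      refine ⟨(C, t), ⟨hC, hCt⟩, fun p hp => ?_⟩
      refine (disjoint_compl_right.mono_right hCs).mono_left (thickening_subset_of_subset _ ?_)
      exact Set.subset_biUnion_of_mem (u := fun p : Set X × ι => p.1) hp)
  exact ⟨ε, hε, fun n => (f n).1, fun n => (f n).2, fun n => (hf n).1, fun n => (hf n).2, hfd⟩

end Tight

/-! ### Comparison of Lipschitz bump functions. -/

section Bump

open Metric

variable {X : Type*} [PseudoMetricSpace X]

/-- If `A` is the nearer set both values agree; otherwise the point is at distance at least `δ` from
the union and the left side vanishes. -/
theorem thickenedIndicator_union_le_of_notMem {δ : ℝ} (hδ : 0 < δ) {A B : Set X} {x : X}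
    (hx : x ∉ thickening δ B) :
    thickenedIndicator hδ (A ∪ B) x ≤ thickenedIndicator hδ A x := by
  rcases le_total (infEDist x A) (infEDist x B) with h | h
  · have hAB : infEDist x (A ∪ B) = infEDist x A := by rw [infEDist_union, min_eq_left h]
    simp [thickenedIndicator_apply, thickenedIndicatorAux, hAB]
  · have hx' : x ∉ thickening δ (A ∪ B) := by
      rw [thickening, Set.mem_ofPred_eq] at hx ⊢
      rwa [infEDist_union, min_eq_right h]
    rw [thickenedIndicator_zero hδ _ hx']
    exact zero_le

variable [MeasurableSpace X] [OpensMeasurableSpace X]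

theorem integrable_coe_thickenedIndicator {δ : ℝ} (hδ : 0 < δ) (A : Set X) (ν : Measure X)
    [IsFiniteMeasure ν] : Integrable (fun x => (thickenedIndicator hδ A x : ℝ)) ν := by
  refine Integrable.of_bound
    (NNReal.continuous_coe.comp (thickenedIndicator hδ A).continuous).measurable.aestronglyMeasurable
    1 (Eventually.of_forall fun x => ?_)
  simpa using thickenedIndicator_le_one hδ A x

/-- On `C` the bump of `A` is 0 while that of `E` is 1. -/
theorem integral_thickenedIndicator_add_le {δ : ℝ} (hδ : 0 < δ) {A C E : Set X} (hAE : A ⊆ E)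
    (hCE : C ⊆ E) (hAC : Disjoint (thickening δ A) C) (hC : MeasurableSet C) (ν : Measure X)
    [IsFiniteMeasure ν] :
    ∫ x, (thickenedIndicator hδ A x : ℝ) ∂ν + ν.real C
      ≤ ∫ x, (thickenedIndicator hδ E x : ℝ) ∂ν := by
  have hint : Integrable (C.indicator (1 : X → ℝ)) ν := (integrable_const (1 : ℝ)).indicator hC
  rw [← integral_indicator_one hC, ← integral_add (integrable_coe_thickenedIndicator hδ A ν) hint]
  refine integral_mono ((integrable_coe_thickenedIndicator hδ A ν).add hint)
    (integrable_coe_thickenedIndicator hδ E ν) fun x => ?_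
  by_cases hx : x ∈ C
  · have h0 := thickenedIndicator_zero hδ A (hAC.notMem_of_mem_right hx)
    have h1 := thickenedIndicator_one hδ E (hCE hx)
    simp [hx, h0, h1]
  · simpa [hx] using thickenedIndicator_subset hδ hAE x

theorem integral_thickenedIndicator_union_le {δ : ℝ} (hδ : 0 < δ) (A B : Set X) (ν : Measure X)
    [IsFiniteMeasure ν] :
    ∫ x, (thickenedIndicator hδ (A ∪ B) x : ℝ) ∂ν
      ≤ ∫ x, (thickenedIndicator hδ A x : ℝ) ∂ν + ν.real (thickening δ B) := by
  have hB : MeasurableSet (thickening δ B) := isOpen_thickening.measurableSet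
  have hint : Integrable ((thickening δ B).indicator (1 : X → ℝ)) ν :=
    (integrable_const (1 : ℝ)).indicator hB
  rw [← integral_indicator_one hB, ← integral_add (integrable_coe_thickenedIndicator hδ A ν) hint]
  refine integral_mono (integrable_coe_thickenedIndicator hδ _ ν)
    ((integrable_coe_thickenedIndicator hδ A ν).add hint)
    fun x => ?_
  by_cases hx : x ∈ thickening δ B
  · have h1 : (thickenedIndicator hδ (A ∪ B) x : ℝ) ≤ 1 := thickenedIndicator_le_one hδ _ x
    have h0 : (0 : ℝ) ≤ thickenedIndicator hδ A x := NNReal.coe_nonneg _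
    simp only [Set.indicator_of_mem hx, Pi.one_apply]
    linarith
  · simpa [hx] using thickenedIndicator_union_le_of_notMem hδ (A := A) hx

end Bump

/-! ### The gliding hump and tightness of the orbit. -/

theorem exists_measure_biUnion_ge_lt {X : Type*} [MeasurableSpace X] (ν : Measure X)
    [IsFiniteMeasure ν] {U : ℕ → Set X} (hU : ∀ i, MeasurableSet (U i))
    (hd : Pairwise (Function.onFun Disjoint U)) {η : ℝ≥0∞} (hη : 0 < η) (k : ℕ) :
    ∃ m, k < m ∧ ν (⋃ j ∈ Set.Ici m, U j) < η := by
  have hlim := tendsto_measure_iInter_atTop (μ := ν) (s := fun m : ℕ => ⋃ j ∈ Set.Ici m, U j)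
    (fun m => (MeasurableSet.biUnion (Set.to_countable _) fun j _ => hU j).nullMeasurableSet)
    (fun m n hmn => Set.biUnion_subset_biUnion_left (Set.Ici_subset_Ici.2 hmn))
    ⟨0, measure_ne_top _ _⟩
  have hempty : (⋂ m : ℕ, ⋃ j ∈ Set.Ici m, U j) = ∅ := by
    refine Set.eq_empty_of_forall_notMem fun x hx => ?_
    rw [Set.mem_iInter] at hx
    obtain ⟨i, -, hi⟩ := Set.mem_iUnion₂.1 (hx 0)
    obtain ⟨j, hj, hj'⟩ := Set.mem_iUnion₂.1 (hx (i + 1))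
    have hij : i ≠ j := by
      have : i + 1 ≤ j := hj
      omega
    exact Set.disjoint_left.1 (hd hij) hi hj'
  rw [hempty, measure_empty] at hlim
  exact ((eventually_gt_atTop k).and (hlim.eventually (gt_mem_nhds hη))).exists

/-- Greedy choice of indices: each index `i` is selected together with an auxiliary `x` and a bound
`m` below which no later index is taken. -/
theorem exists_index_selection {Y : Type*} {R : ℕ → Finset ℕ → ℕ → Y → ℕ → Prop}
    (h : ∀ n J k, ∃ i x m, k ≤ i ∧ i < m ∧ R n J i x m) :
    ∃ I : Set ℕ, ∀ n, ∃ (J : Finset ℕ) (i : ℕ) (x : Y) (m : ℕ), R n J i x m ∧ ↑J ⊆ I ∧ i ∈ I ∧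
      (∀ j ∈ J, j < i) ∧ I ⊆ ↑J ∪ ({i} ∪ Set.Ici m) := by
  choose i x m hki him hR using h
  -- The state holds the indices chosen so far and the lower bound for the next one.
  let a : ℕ → Finset ℕ × ℕ := fun n =>
    n.rec (∅, 0) fun n p => (insert (i n p.1 p.2) p.1, m n p.1 p.2)
  let b : ℕ → ℕ := fun n => i n (a n).1 (a n).2
  have ha1 : ∀ n, (a (n + 1)).1 = insert (b n) (a n).1 := fun n => rfl
  have ha2 : ∀ n, (a (n + 1)).2 = m n (a n).1 (a n).2 := fun n => rfl
  have hab : ∀ n, (a n).2 ≤ b n := fun n => hki _ _ _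
  have hba : ∀ n, b n < (a (n + 1)).2 := fun n => him _ _ _
  have hmono : Monotone fun n => (a n).2 :=
    monotone_nat_of_le_succ fun n => (hab n).trans (hba n).le
  have hJ : ∀ n j, j ∈ (a n).1 ↔ ∃ k < n, b k = j := by
    intro n
    induction n with
    | zero => intro j; simp [a]
    | succ n ih =>
      intro j
      rw [ha1, Finset.mem_insert, ih]
      constructor
      · rintro (rfl | ⟨k, hk, rfl⟩)
        · exact ⟨n, by omega, rfl⟩
        · exact ⟨k, by omega, rfl⟩
      · rintro ⟨k, hk, rfl⟩
        rcases Nat.lt_succ_iff_lt_or_eq.1 hk with hk | rfl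
        · exact Or.inr ⟨k, hk, rfl⟩
        · exact Or.inl rfl
  refine ⟨Set.range b, fun n => ⟨(a n).1, b n, x n (a n).1 (a n).2, (a (n + 1)).2, hR _ _ _, ?_,
    ⟨n, rfl⟩, ?_, ?_⟩⟩
  · intro j hj
    obtain ⟨k, -, rfl⟩ := (hJ n j).1 hj
    exact ⟨k, rfl⟩
  · intro j hj
    obtain ⟨k, hk, rfl⟩ := (hJ n j).1 hj
    exact (hba k).trans_le ((hmono hk).trans (hab n))
  · rintro _ ⟨k, rfl⟩
    rcases lt_trichotomy k n with hk | rfl | hk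
    · exact Or.inl ((hJ n _).2 ⟨k, hk, rfl⟩)
    · exact Or.inr (Or.inl rfl)
    · exact Or.inr (Or.inr ((hmono hk).trans (hab k)))

namespace MarkovSemigroup

open Metric

variable {X : Type*} [MetricSpace X] [MeasurableSpace X]

theorem HasEProperty.thickenedIndicator {P : MarkovSemigroup X} (he : P.HasEProperty) {δ : ℝ}
    (hδ : 0 < δ) (A : Set X) (z : X) {ε : ℝ} (hε : 0 < ε) :
    ∃ r : ℝ, 0 < r ∧ ∀ x ∈ ball z r, ∀ t : ℝ≥0,
      |P.op t (fun y => (thickenedIndicator hδ A y : ℝ)) z -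
        P.op t (fun y => (thickenedIndicator hδ A y : ℝ)) x| < ε := by
  refine he _ ⟨1, fun x => ?_⟩ ⟨δ.toNNReal⁻¹, fun x y => ?_⟩ z ε hε
  · simpa using thickenedIndicator_le_one hδ A x
  · exact lipschitzWith_thickenedIndicator hδ A x y

variable [BorelSpace X] (P : MarkovSemigroup X)

/-- A gliding hump argument: under the e-property the transition probabilities from a point `z`
all of whose neighbourhoods are charged by long time averages cannot escape along a sequence of
uniformly separated sets. -/
theorem not_separated_of_hasEProperty (he : P.HasEProperty) {z : X}
    (hz : ∀ ε : ℝ, 0 < ε → 0 < limsup (fun T : ℝ => ⨆ μ : ProbabilityMeasure X,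
        P.timeAverage T (μ : Measure X) (ball z ε)) atTop)
    {ε : ℝ} (hε : 0 < ε) {K : ℕ → Set X} {t : ℕ → ℝ≥0} (hK : ∀ n, IsCompact (K n))
    (hKt : ∀ n, ENNReal.ofReal ε < P.kernel (t n) z (K n))
    (hd : ∀ m n, m < n → Disjoint (thickening ε (K m)) (K n)) : False := by
  have hδ : 0 < ε / 2 := by linarith
  set U : ℕ → Set X := fun i => thickening (ε / 2) (K i) with hUdef
  have hU : ∀ i, MeasurableSet (U i) := fun i => isOpen_thickening.measurableSet
  have hUlt : ∀ m n, m < n → Disjoint (U m) (U n) := by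
    intro m n hmn
    refine Set.disjoint_left.2 fun x hxm hxn => ?_
    obtain ⟨y, hy, hxy⟩ := mem_thickening_iff.1 hxm
    obtain ⟨w, hw, hxw⟩ := mem_thickening_iff.1 hxn
    refine Set.disjoint_left.1 (hd m n hmn) (mem_thickening_iff.2 ⟨y, hy, ?_⟩) hw
    rw [dist_comm] at hxw
    linarith [dist_triangle w x y]
  have hUd : Pairwise (Function.onFun Disjoint U) := fun m n hmn =>
    hmn.lt_or_gt.elim (hUlt m n) fun h => (hUlt n m h).symm
  set F : Set ℕ → X → ℝ := fun I x => (thickenedIndicator hδ (⋃ i ∈ I, K i) x : ℝ)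
  have hη : 0 < ε / 4 := by linarith
  have hη' : 0 < ENNReal.ofReal (ε / 4) := ENNReal.ofReal_pos.2 hη
  -- The final set `I` is unknown during the selection, so closeness at stage `n` is imposed only
  -- for the finite part `J`; the tail beyond `m` is made negligible at `x`.
  obtain ⟨I, hI⟩ := exists_index_selection (Y := X)
    (R := fun n J i x m => dist x z < 1 / ((n : ℝ) + 1) ∧
      (∀ s, |P.op s (F J) z - P.op s (F J) x| < ε / 4) ∧
      P.kernel (t i) x (U i) < ENNReal.ofReal (ε / 4) ∧
      P.kernel (t i) x (⋃ j ∈ Set.Ici m, U j) < ENNReal.ofReal (ε / 4)) (by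
    intro n J k
    obtain ⟨r, hr, hrJ⟩ := he.thickenedIndicator hδ (⋃ i ∈ (J : Set ℕ), K i) z hη
    obtain ⟨i, hki, x, hx, hxi⟩ := P.exists_kernel_lt _
      (hz (min r (1 / ((n : ℝ) + 1))) (lt_min hr (by positivity))) hU hUd t hη' k
    obtain ⟨m, him, hm⟩ := exists_measure_biUnion_ge_lt (P.kernel (t i) x) hU hUd hη' i
    exact ⟨i, x, m, hki, him, (mem_ball.1 hx).trans_le (min_le_right _ _),
      hrJ x (ball_subset_ball (min_le_left _ _) hx), hxi, hm⟩)
  -- Passing from `z` to `x` costs `ε / 4` for each of `F I` and `F J`, and `U i` and the tail cost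
  -- `ε / 4` each; together they cancel the gain `ε` from `K i` at `z`.
  obtain ⟨r, hr, hrI⟩ := he.thickenedIndicator hδ (⋃ i ∈ I, K i) z hη
  obtain ⟨n, hn⟩ := exists_nat_one_div_lt hr
  obtain ⟨J, i, x, m, ⟨hx, hJ, hi, hm⟩, hJI, hiI, hJi, hIJ⟩ := hI n
  have h1 := hrI x (mem_ball.2 (hx.trans hn)) (t i)
  have h2 := hJ (t i)
  have h3 : P.op (t i) (F J) z + ε < P.op (t i) (F I) z := by
    have h := integral_thickenedIndicator_add_le hδ (A := ⋃ i ∈ (J : Set ℕ), K i)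
      (Set.biUnion_subset_biUnion_left hJI) (Set.subset_biUnion_of_mem hiI) (by
        simp only [thickening_iUnion, Set.disjoint_iUnion_left]
        intro j hj
        exact (hUlt j i (hJi j hj)).mono_right (self_subset_thickening hδ _))
      (hK i).isClosed.measurableSet (P.kernel (t i) z)
    have hε' : ε < (P.kernel (t i) z).real (K i) :=
      (ENNReal.ofReal_lt_iff_lt_toReal hε.le (measure_ne_top _ _)).1 (hKt i)
    exact (add_lt_add_right hε' _).trans_le h
  have h4 : P.op (t i) (F I) x ≤ P.op (t i) (F J) x + ε / 2 := by
    set B : Set X := ⋃ j ∈ ({i} ∪ Set.Ici m : Set ℕ), K j with hB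
    have h := integral_thickenedIndicator_union_le hδ (⋃ i ∈ (J : Set ℕ), K i) B
      (P.kernel (t i) x)
    have hle : P.op (t i) (F I) x ≤ ∫ y, (thickenedIndicator hδ
        ((⋃ i ∈ (J : Set ℕ), K i) ∪ B) y : ℝ) ∂(P.kernel (t i) x) := by
      refine integral_mono (integrable_coe_thickenedIndicator hδ _ _)
        (integrable_coe_thickenedIndicator hδ _ _) fun y => ?_
      refine thickenedIndicator_subset hδ ?_ y
      rw [hB, ← Set.biUnion_union]
      exact Set.biUnion_subset_biUnion_left hIJ
    have hBU : thickening (ε / 2) B = U i ∪ ⋃ j ∈ Set.Ici m, U j := by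
      rw [hB, Set.biUnion_union, thickening_union]
      simp [thickening_iUnion, hUdef]
    have hUi : (P.kernel (t i) x).real (U i) ≤ ε / 4 := ENNReal.toReal_le_of_le_ofReal hη.le hi.le
    have hUm : (P.kernel (t i) x).real (⋃ j ∈ Set.Ici m, U j) ≤ ε / 4 :=
      ENNReal.toReal_le_of_le_ofReal hη.le hm.le
    rw [hBU] at h
    have := measureReal_union_le (μ := P.kernel (t i) x) (U i) (⋃ j ∈ Set.Ici m, U j)
    have h5 : P.op (t i) (F J) x = ∫ y, (thickenedIndicator hδ (⋃ i ∈ (J : Set ℕ), K i) y : ℝ)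
      ∂(P.kernel (t i) x) := rfl
    linarith
  have h1' := (abs_lt.1 h1).2
  have h2' := (abs_lt.1 h2).1
  change P.op (t i) (F I) z - P.op (t i) (F I) x < ε / 4 at h1'
  linarith

theorem isTightMeasureSet_kernel [CompleteSpace X] [TopologicalSpace.SeparableSpace X]
    (he : P.HasEProperty) {z : X}
    (hz : ∀ ε : ℝ, 0 < ε → 0 < limsup (fun T : ℝ => ⨆ μ : ProbabilityMeasure X,
        P.timeAverage T (μ : Measure X) (ball z ε)) atTop) :
    IsTightMeasureSet (Set.range fun t => P.kernel t z) := by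
  by_contra h
  obtain ⟨ε, hε, K, t, hK, hKt, hd⟩ := exists_separated_of_not_isTightMeasureSet h
  exact P.not_separated_of_hasEProperty he hz hε hK hKt hd

end MarkovSemigroup

/-! ### Krylov-Bogoliubov averaging along dyadic times. -/

theorem abs_sum_range_shift_sub_le {a : ℕ → ℝ} {C : ℝ} (ha : ∀ k, |a k| ≤ C) (N j : ℕ) :
    |∑ k ∈ Finset.range N, a (k + j) - ∑ k ∈ Finset.range N, a k| ≤ 2 * C * j := by
  induction j with
  | zero => simp
  | succ j ih =>
    have h : ∑ k ∈ Finset.range N, a (k + (j + 1)) =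
        ∑ k ∈ Finset.range N, a (k + j) + a (N + j) - a j := by
      have h1 := Finset.sum_range_succ (fun k => a (k + j)) N
      rw [Finset.sum_range_succ'] at h1
      simp only [zero_add, add_right_comm _ 1 j] at h1
      simp only [← add_assoc, add_right_comm _ j 1]
      have h2 : ∀ k, a (k + 1 + j) = a (k + j + 1) := fun k => by rw [add_right_comm]
      simp only [h2] at h1 ⊢
      linarith
    rw [h]
    have h1 := abs_le.1 ih
    have h2 := abs_le.1 (ha (N + j))
    have h3 := abs_le.1 (ha j)
    push_cast
    rw [abs_le]
    constructor <;> linarith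

theorem tendsto_floor_add_one_div_two_pow (t : ℝ≥0) :
    ∃ k : ℕ → ℕ, ∃ s : ℕ → ℝ≥0, (∀ m, (k m : ℝ≥0) * (2 ^ m)⁻¹ = t + s m) ∧
      Tendsto s atTop (𝓝[>] 0) := by
  have hlt : ∀ m : ℕ, t < (⌊t * 2 ^ m⌋₊ + 1 : ℕ) * (2 ^ m : ℝ≥0)⁻¹ := fun m => by
    rw [← div_eq_mul_inv, lt_div_iff₀ (by positivity)]
    push_cast
    exact Nat.lt_floor_add_one _
  have hle : ∀ m : ℕ, (⌊t * 2 ^ m⌋₊ + 1 : ℕ) * (2 ^ m : ℝ≥0)⁻¹ - t ≤ (2⁻¹ : ℝ≥0) ^ m := fun m => by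
    rw [tsub_le_iff_left, inv_pow, ← div_eq_mul_inv, div_le_iff₀ (by positivity), add_mul,
      inv_mul_cancel₀ (by positivity)]
    push_cast
    gcongr
    exact Nat.floor_le zero_le
  -- The `+ 1` keeps the remainder strictly positive, as the limit within `𝓝[>] 0` requires.
  refine ⟨fun m => ⌊t * 2 ^ m⌋₊ + 1, fun m => (⌊t * 2 ^ m⌋₊ + 1 : ℕ) * (2 ^ m : ℝ≥0)⁻¹ - t,
    fun m => (add_tsub_cancel_of_le (hlt m).le).symm, tendsto_nhdsWithin_iff.2 ⟨?_, ?_⟩⟩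
  · refine tendsto_of_tendsto_of_tendsto_of_le_of_le tendsto_const_nhds
      (NNReal.tendsto_pow_atTop_nhds_zero_of_lt_one ?_) (fun m => zero_le) hle
    exact inv_lt_one_of_one_lt₀ (by norm_num)
  · exact Eventually.of_forall fun m => tsub_pos_of_lt (hlt m)

theorem BoundedContinuousFunction.exists_abs_le {X : Type*} [TopologicalSpace X] (ψ : X →ᵇ ℝ) :
    ∃ C : ℝ, ∀ x, |ψ x| ≤ C := ⟨‖ψ‖, ψ.norm_coe_le_norm⟩

namespace MarkovSemigroup

variable {X : Type*}

section Average

variable [MeasurableSpace X] (P : MarkovSemigroup X)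

/-- The Cesàro average `(1/N) ∑_{k < N} P_{kh}(z, ·)`. -/
noncomputable def orbitAverage (h : ℝ≥0) (N : ℕ) (z : X) : Measure X :=
  (N : ℝ≥0∞)⁻¹ • ∑ k ∈ Finset.range N, P.kernel (k * h) z

theorem orbitAverage_apply_le {h : ℝ≥0} {N : ℕ} {z : X} {A : Set X} {c : ℝ≥0∞}
    (hc : ∀ t, P.kernel t z A ≤ c) : P.orbitAverage h N z A ≤ c := by
  rw [orbitAverage, Measure.smul_apply, Measure.finsetSum_apply, smul_eq_mul]
  calc (N : ℝ≥0∞)⁻¹ * ∑ k ∈ Finset.range N, P.kernel (k * h) z A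
      ≤ (N : ℝ≥0∞)⁻¹ * (N * c) := by
        gcongr
        simpa using Finset.sum_le_card_nsmul (Finset.range N) _ c fun k _ => hc (k * h)
    _ ≤ c := by
        rw [← mul_assoc]
        exact (mul_le_mul_left (ENNReal.inv_mul_le_one _) c).trans_eq (one_mul c)

theorem isProbabilityMeasure_orbitAverage (h : ℝ≥0) {N : ℕ} (hN : N ≠ 0) (z : X) :
    IsProbabilityMeasure (P.orbitAverage h N z) := by
  constructor
  rw [orbitAverage, Measure.smul_apply, Measure.finsetSum_apply, smul_eq_mul]
  simp [ENNReal.inv_mul_cancel, hN]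

theorem integral_orbitAverage (h : ℝ≥0) (N : ℕ) (z : X) {ψ : X → ℝ} (hψ : Measurable ψ) {C : ℝ}
    (hC : ∀ x, |ψ x| ≤ C) :
    ∫ x, ψ x ∂(P.orbitAverage h N z) = (N : ℝ)⁻¹ * ∑ k ∈ Finset.range N, P.op (k * h) ψ z := by
  rw [orbitAverage, integral_smul_measure, integral_finsetSum_measure]
  · simp [op]
  · exact fun k _ => Integrable.of_bound hψ.aestronglyMeasurable C (Eventually.of_forall hC)

theorem abs_integral_op_orbitAverage_sub_le (h : ℝ≥0) (N j : ℕ) (z : X) {ψ : X → ℝ}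
    (hψ : Measurable ψ) {C : ℝ} (hC : ∀ x, |ψ x| ≤ C) :
    |∫ x, P.op (j * h) ψ x ∂(P.orbitAverage h N z) - ∫ x, ψ x ∂(P.orbitAverage h N z)|
      ≤ (N : ℝ)⁻¹ * (2 * C * j) := by
  rw [P.integral_orbitAverage h N z hψ hC, P.integral_orbitAverage h N z
    (P.measurable_op _ hψ) (P.abs_op_le _ hC), ← mul_sub, abs_mul, abs_of_nonneg (by positivity)]
  gcongr
  have hadd : ∀ k : ℕ, P.op (k * h) (P.op (j * h) ψ) z = P.op ((k + j : ℕ) * h) ψ z := fun k => by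
    rw [← P.op_add _ _ hψ ⟨C, hC⟩, Nat.cast_add, add_mul]
  simp only [hadd]
  exact abs_sum_range_shift_sub_le (a := fun k : ℕ => P.op (k * h) ψ z)
    (fun k => P.abs_op_le _ hC z) N j

theorem isInvariant_of_dual_eq {μ : Measure X} [IsProbabilityMeasure μ]
    (h : ∀ t, P.dual t μ = μ) : P.IsInvariant μ := by
  intro ψ hψ hb t
  rw [← P.integral_dual t μ hψ hb, h t]

theorem dual_nat_mul_eq {μ : Measure X} {h : ℝ≥0} (hμ : P.dual h μ = μ) (k : ℕ) :
    P.dual (k * h) μ = μ := by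
  induction k with
  | zero => simp [dual_zero]
  | succ k ih => rw [Nat.cast_succ, add_mul, one_mul, dual_add, ih, hμ]

end Average

variable [MetricSpace X] [MeasurableSpace X] [BorelSpace X] {P : MarkovSemigroup X}

/-- Dyadic times `t + s m` decrease towards `t`: there the dual fixes `μ`, while stochastic
continuity sends `P_{s m}^* P_t^* μ` weakly to `P_t^* μ`. -/
theorem IsStochasticallyContinuous.dual_eq_of_dyadic (hcont : P.IsStochasticallyContinuous)
    {μ : Measure X} [IsProbabilityMeasure μ] (hμ : ∀ m : ℕ, P.dual (2 ^ m)⁻¹ μ = μ) (t : ℝ≥0) :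
    P.dual t μ = μ := by
  refine ext_of_forall_integral_eq_of_IsFiniteMeasure fun ψ => ?_
  obtain ⟨C, hC⟩ := ψ.exists_abs_le
  obtain ⟨k, s, hks, hs⟩ := tendsto_floor_add_one_div_two_pow t
  have hlim : Tendsto (fun m => ∫ x, P.op (s m) ψ x ∂(P.dual t μ)) atTop
      (𝓝 (∫ x, ψ x ∂(P.dual t μ))) := by
    refine tendsto_integral_of_dominated_convergence (fun _ => C)
      (fun m => (P.measurable_op _ ψ.continuous.measurable).aestronglyMeasurable)
      (integrable_const C) (fun m => Eventually.of_forall fun x => P.abs_op_le _ hC x)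
      (Eventually.of_forall fun x => (hcont ψ x).comp hs)
  have hconst : ∀ m, ∫ x, P.op (s m) ψ x ∂(P.dual t μ) = ∫ x, ψ x ∂μ := fun m => by
    rw [← P.integral_dual _ _ ψ.continuous.measurable ⟨C, hC⟩, ← dual_add, ← hks,
      P.dual_nat_mul_eq (hμ m)]
  simp only [hconst] at hlim
  exact tendsto_nhds_unique tendsto_const_nhds hlim |>.symm

/-- The Krylov-Bogoliubov theorem: a tight orbit yields an invariant probability measure. -/
theorem exists_isInvariant_of_isTightMeasureSet (hFeller : P.IsFeller)
    (hcont : P.IsStochasticallyContinuous) {z : X}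
    (htight : IsTightMeasureSet (Set.range fun t => P.kernel t z)) :
    ∃ μ : ProbabilityMeasure X, P.IsInvariant (μ : Measure X) := by
  -- With step `2⁻ⁿ` and `4ⁿ` terms, a shift by `2⁻ᵐ` is `2 ^ (n - m)` steps and changes the average
  -- by at most `2 * C * 2⁻ⁿ`, so one limit serves all `m`.
  let ν : ℕ → ProbabilityMeasure X := fun n =>
    ⟨P.orbitAverage (2 ^ n)⁻¹ (4 ^ n) z, P.isProbabilityMeasure_orbitAverage _ (by positivity) z⟩
  have hν : IsTightMeasureSet {((μ : ProbabilityMeasure X) : Measure X) | μ ∈ Set.range ν} := by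
    rw [isTightMeasureSet_iff_exists_isCompact_measure_compl_le] at htight ⊢
    intro ε hε
    obtain ⟨K, hK, hKε⟩ := htight ε hε
    refine ⟨K, hK, ?_⟩
    rintro _ ⟨_, ⟨n, rfl⟩, rfl⟩
    exact P.orbitAverage_apply_le fun t => hKε _ ⟨t, rfl⟩
  -- Prokhorov compactness, with a limit along a nonprincipal ultrafilter in place of a subsequence.
  obtain ⟨μ, -, hμ⟩ := (isCompact_closure_of_isTightMeasureSet hν).ultrafilter_le_nhds'
    ((hyperfilter ℕ).map ν) (mem_map.2 (Eventually.of_forall fun n => subset_closure ⟨n, rfl⟩))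
  have hlim : Tendsto ν (hyperfilter ℕ : Filter ℕ) (𝓝 μ) := hμ
  rw [ProbabilityMeasure.tendsto_iff_forall_integral_tendsto] at hlim
  refine ⟨μ, P.isInvariant_of_dual_eq (hcont.dual_eq_of_dyadic fun m => ?_)⟩
  refine ext_of_forall_integral_eq_of_IsFiniteMeasure fun ψ => ?_
  obtain ⟨C, hC⟩ := ψ.exists_abs_le
  have hψ : Measurable ψ := ψ.continuous.measurable
  rw [P.integral_dual _ _ hψ ⟨C, hC⟩]
  let φ : X →ᵇ ℝ := BoundedContinuousFunction.ofNormedAddCommGroup (P.op (2 ^ m)⁻¹ ψ)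
    (hFeller _ (by positivity) ψ) C (P.abs_op_le _ hC)
  have h1 := (hlim φ).sub (hlim ψ)
  have h2 : Tendsto (fun n => ∫ x, φ x ∂(ν n : Measure X) - ∫ x, ψ x ∂(ν n : Measure X)) atTop
      (𝓝 0) := by
    have h0 : Tendsto (fun n : ℕ => 2 * C * (2⁻¹ : ℝ) ^ n) atTop (𝓝 0) := by
      simpa using (tendsto_pow_atTop_nhds_zero_of_lt_one (r := (2⁻¹ : ℝ)) (by norm_num)
        (by norm_num)).const_mul (2 * C)
    refine squeeze_zero_norm' ?_ h0
    filter_upwards [eventually_ge_atTop m] with n hn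
    have hmn : ((2 ^ (n - m) : ℕ) : ℝ≥0) * (2 ^ n)⁻¹ = (2 ^ m)⁻¹ := by
      obtain ⟨d, rfl⟩ := Nat.exists_eq_add_of_le hn
      rw [Nat.add_sub_cancel_left, pow_add]
      push_cast
      field_simp
    have hb := P.abs_integral_op_orbitAverage_sub_le (2 ^ n)⁻¹ (4 ^ n) (2 ^ (n - m)) z hψ hC
    rw [hmn] at hb
    refine hb.trans ?_
    have hC0 : 0 ≤ C := (abs_nonneg _).trans (hC z)
    have hpow : (2 : ℝ) ^ (n - m) ≤ 2 ^ n := pow_le_pow_right₀ (by norm_num) (Nat.sub_le n m)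
    have h4 : (4 : ℝ) ^ n = 2 ^ n * 2 ^ n := by rw [← mul_pow]; norm_num
    push_cast
    calc ((4 : ℝ) ^ n)⁻¹ * (2 * C * 2 ^ (n - m)) ≤ ((4 : ℝ) ^ n)⁻¹ * (2 * C * 2 ^ n) := by gcongr
      _ = 2 * C * 2⁻¹ ^ n := by rw [h4, inv_pow]; field_simp
  have h3 := tendsto_nhds_unique h1 (h2.mono_left Nat.hyperfilter_le_atTop)
  exact sub_eq_zero.1 h3

end MarkovSemigroup

theorem mainTheorem4 {X : Type*} [MetricSpace X] [CompleteSpace X]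
    [TopologicalSpace.SeparableSpace X] [MeasurableSpace X] [BorelSpace X]
    (P : MarkovSemigroup X) (hFeller : P.IsFeller) (hcont : P.IsStochasticallyContinuous)
    (hz : ∃ z : X, ∀ ε : ℝ, 0 < ε →
      0 < limsup (fun T : ℝ => ⨆ μ : ProbabilityMeasure X,
        P.timeAverage T (μ : Measure X) (Metric.ball z ε)) atTop)
    (he : P.HasEProperty) :
    ∃ μ : ProbabilityMeasure X, P.IsInvariant (μ : Measure X) := by
  obtain ⟨z, hz⟩ := hz
  exact MarkovSemigroup.exists_isInvariant_of_isTightMeasureSet hFeller hcont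
    (P.isTightMeasureSet_kernel he hz)
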